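/- Let $n\ge 2$, let $P\in\mathbb R^n$, let $|\cdot|$ be the Euclidean norm, and for $\kappa,b\in\mathbb R$ let $$S_{\kappa,b}=\{X\in\mathbb R^n : |X|+\kappa\,|X-P|=b\}.$$ The region enclosed by a surface $S\subset\mathbb R^n$ is the union of $S$ with the bounded connected components of $\mathbb R^n\setminus S$. The surface $S$ is called convex if the region it encloses is a convex set, and concave if every point of $S$ is the center of an open ball whose intersection with the complement of the enclosed region is convex (in particular, $S$ is concave if the complement of the enclosed region is convex). 1. Suppose $-1<\kappa<0$. Then $S_{\kappa,b}$ is (a) convex when $b\in[\kappa|P|,(1+\kappa)|P|]$; (b) neither convex nor concave when $b\in((1+\kappa)|P|,|P|)$. 2. Suppose $\kappa<-1$. Then $S_{\kappa,b}$ is (a) convex when $b\in[(1+\kappa)|P|,|P|)$; (b) neither convex nor concave when $b\in(\kappa|P|,(1+\kappa)|P|)$. -/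

import Mathlib

/-- The surface `|X| + κ |X - P| = b` in Euclidean `n`-space. -/
def oval {n : ℕ} (κ : ℝ) (P : EuclideanSpace ℝ (Fin n)) (b : ℝ) :
    Set (EuclideanSpace ℝ (Fin n)) :=
  {X | ‖X‖ + κ * ‖X - P‖ = b}

/-- The closed region enclosed by a surface `S`: the points of `S`, together with all bounded
connected components of the complement of `S`. -/
def enclosedRegion {n : ℕ} (S : Set (EuclideanSpace ℝ (Fin n))) :
    Set (EuclideanSpace ℝ (Fin n)) :=
  S ∪ {X | X ∉ S ∧ Bornology.IsBounded (connectedComponentIn Sᶜ X)}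

/-- A surface is convex if the region that it encloses is a convex set. -/
def IsConvexSurface {n : ℕ} (S : Set (EuclideanSpace ℝ (Fin n))) : Prop :=
  Convex ℝ (enclosedRegion S)

/-- A surface is concave if, near each of its points, the region outside of it is convex, that is,
the surface bends everywhere away from the side that it encloses. (If the whole outer region is
convex, then the surface is concave in this sense, so that failing to be concave here is the
stronger assertion.) -/
def IsConcaveSurface {n : ℕ} (S : Set (EuclideanSpace ℝ (Fin n))) : Prop :=
  ∀ X ∈ S, ∃ r > 0, Convex ℝ (Metric.ball X r ∩ (enclosedRegion S)ᶜ)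

/-! Both cases concern `focalDiff k A B` with `0 < k < 1`: take `k = -κ` and foci `0, P` if `-1 < κ
< 0`; if `κ < -1`, divide by `κ` and exchange the foci, so `k = -κ⁻¹`. The function increases along
rays from `A` outside that point and has bounded sublevel sets, so the enclosed region is a sublevel
set. Write `r`, `s` for the distances to `A`, `B`. A tangent hyperplane supports the sublevel set
wherever `k r ≤ s` (`norm_sub_lt_of_inner_pos`). By the triangle inequality this holds on the whole
level set once `b ≤ (1 - k) ‖A - B‖`, which gives convexity. For larger `b < ‖A - B‖`, the axis
point between the foci has `s < k r` and the surface is dented there, while at the axis point beyond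
`A` it bulges outward. -/

section FocalDiff

variable {E : Type*} [NormedAddCommGroup E]

/-- The weighted difference of the distances to the foci `A` and `B`. -/
def focalDiff (k : ℝ) (A B X : E) : ℝ := ‖X - A‖ - k * ‖X - B‖

theorem continuous_focalDiff (k : ℝ) (A B : E) : Continuous (focalDiff k A B) := by
  unfold focalDiff
  fun_prop

theorem focalDiff_lower_bound {k : ℝ} (hk : 0 ≤ k) (A B X : E) :
    (1 - k) * ‖X - A‖ - k * ‖A - B‖ ≤ focalDiff k A B X := by
  have h : ‖X - B‖ ≤ ‖X - A‖ + ‖A - B‖ := norm_sub_le_norm_sub_add_norm_sub X A B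
  unfold focalDiff
  nlinarith

theorem focalDiff_left (k : ℝ) (A B : E) : focalDiff k A B A = -(k * ‖A - B‖) := by
  simp [focalDiff]

variable [InnerProductSpace ℝ E]

theorem focalDiff_lt_of_one_lt {k : ℝ} (hk : 0 ≤ k) (hk1 : k < 1) {A B X : E} (hX : X ≠ A)
    {t : ℝ} (ht : 1 < t) :
    focalDiff k A B X < focalDiff k A B (A + t • (X - A)) := by
  have hpos : 0 < ‖X - A‖ := norm_pos_iff.2 (sub_ne_zero.2 hX)
  have h1 : ‖A + t • (X - A) - A‖ = t * ‖X - A‖ := by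
    rw [add_sub_cancel_left, norm_smul, Real.norm_of_nonneg (by linarith)]
  have h2 : ‖A + t • (X - A) - B‖ ≤ ‖X - B‖ + (t - 1) * ‖X - A‖ := by
    have : A + t • (X - A) - B = (X - B) + (t - 1) • (X - A) := by module
    rw [this]
    refine (norm_add_le _ _).trans ?_
    rw [norm_smul, Real.norm_of_nonneg (by linarith)]
  unfold focalDiff
  rw [h1]
  have h3 := mul_le_mul_of_nonneg_left h2 hk
  nlinarith [mul_pos (mul_pos (sub_pos.2 ht) hpos) (sub_pos.2 hk1)]

/-! ### Supporting hyperplanes and convexity of sublevel sets -/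

/-- Where `k r ≤ s`, the sublevel set lies on one side of the tangent hyperplane. -/
theorem norm_sub_lt_of_inner_pos {k : ℝ} (hk : 0 < k) (hk1 : k < 1) {z w h : E}
    (hz : z ≠ 0) (hw : w ≠ 0) (hzw : k * ‖z‖ ≤ ‖w‖)
    (hpos : 0 < inner ℝ (‖z‖⁻¹ • z - (k * ‖w‖⁻¹) • w) h) :
    ‖z‖ - k * ‖w‖ < ‖z + h‖ - k * ‖w + h‖ := by
  have hr : 0 < ‖z‖ := norm_pos_iff.2 hz
  have hs : 0 < ‖w‖ := norm_pos_iff.2 hw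
  rw [inner_sub_left, real_inner_smul_left, real_inner_smul_left] at hpos
  have hA := norm_add_sq_real z h
  have hB := norm_add_sq_real w h
  set r := ‖z‖
  set s := ‖w‖
  set α := r⁻¹ * inner ℝ z h with hα
  set β := s⁻¹ * inner ℝ w h with hβ
  have eα : inner ℝ z h = r * α := by rw [hα]; field_simp
  have eβ : inner ℝ w h = s * β := by rw [hβ]; field_simp
  have hαβ : k * β < α := by rw [hβ]; linarith
  rw [eα] at hA
  rw [eβ] at hB
  set a := ‖z + h‖
  set c := ‖w + h‖
  set q := ‖h‖ ^ 2 with hq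
  have ha : 0 ≤ a := norm_nonneg _
  have hc : 0 ≤ c := norm_nonneg _
  have hq0 : 0 ≤ q := by positivity
  have hβq : β ^ 2 ≤ q := by
    have h1 : |inner ℝ w h| ≤ s * ‖h‖ := abs_real_inner_le_norm w h
    rw [eβ, abs_mul, abs_of_pos hs] at h1
    have h2 : |β| ≤ ‖h‖ := le_of_mul_le_mul_left h1 hs
    rw [← sq_abs]
    exact pow_le_pow_left₀ (abs_nonneg _) h2 2
  -- the defect `c - s - β` lies between `0` and `q / (2 s)`
  have hδ0 : 0 ≤ c - s - β := by
    have : s + β ≤ c := le_of_abs_le (abs_le_of_sq_le_sq (by nlinarith) hc)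
    linarith
  have hδ1 : 2 * s * (c - s - β) ≤ q := by nlinarith [sq_nonneg (c - s)]
  -- With `δ = c - s - β`, one has `(c - s)² = q - 2 s δ`, so `(r - k s + k c)² = r² + 2 r k β + k²
  -- q + 2 k (r - k s) δ`. This bound makes it at most `r² + 2 r k β + q`, which is below `a²`
  -- because `k β < α`.
  have key : 2 * k * (r - k * s) * (c - s - β) ≤ (1 - k ^ 2) * q := by
    have h1 : k * (r - k * s) ≤ (1 - k ^ 2) * s := by nlinarith
    have h2 := mul_le_mul_of_nonneg_right h1 hδ0
    have h3 : 0 ≤ 1 - k ^ 2 := by nlinarith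
    nlinarith [mul_le_mul_of_nonneg_left hδ1 h3]
  have hsq : (r - k * s + k * c) ^ 2 < a ^ 2 := by
    nlinarith [mul_lt_mul_of_pos_left hαβ hr]
  have := lt_of_abs_lt (abs_lt_of_sq_lt_sq hsq ha)
  linarith

/-- If a convex combination `W` left the sublevel set, the segment from `A` to `W` would cross the
level set at some `Z`. The tangent hyperplane at `Z` keeps `X` and `Y`, hence `W`, on its inner
side, yet its normal points outward along `Z - A`, so `W` lies strictly beyond it. -/
theorem convex_focalDiff_le {k b : ℝ} (hk : 0 < k) (hk1 : k < 1) {A B : E}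
    (hb : b ≤ (1 - k) * ‖A - B‖) : Convex ℝ {X | focalDiff k A B X ≤ b} := by
  intro X hX Y hY a c ha hc hac
  by_contra hW
  simp only [Set.mem_ofPred_eq, not_le] at hX hY hW
  -- For such `b` the sublevel set contains at most the point `A`.
  rcases le_or_gt b (-(k * ‖A - B‖)) with hb0 | hb0
  · have aux : ∀ V, focalDiff k A B V ≤ b → V = A := by
      intro V hV
      have h1 := focalDiff_lower_bound hk.le A B V
      have h2 : ‖V - A‖ ≤ 0 := by
        by_contra hcon
        push Not at hcon
        nlinarith [mul_pos (sub_pos.2 hk1) hcon]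
      exact sub_eq_zero.1 (norm_le_zero_iff.1 h2)
    have e : a • X + c • Y = X := by
      rw [aux Y hY, ← aux X hX, ← add_smul, hac, one_smul]
    rw [e] at hW
    linarith
  set W := a • X + c • Y with hWdef
  have hp : 0 < ‖A - B‖ := by nlinarith
  obtain ⟨t, ⟨ht0, ht1⟩, htb⟩ : b ∈ (fun t : ℝ => focalDiff k A B (A + t • (W - A))) ''
      Set.Ioo 0 1 := by
    refine intermediate_value_Ioo zero_le_one ?_ ⟨?_, ?_⟩
    · exact ((continuous_focalDiff k A B).comp (by fun_prop)).continuousOn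
    · simpa [focalDiff_left] using hb0
    · simpa using hW
  set Z := A + t • (W - A) with hZ
  replace htb : focalDiff k A B Z = b := htb
  have hZA : Z - A ≠ 0 := by
    intro h0
    rw [sub_eq_zero.1 h0, focalDiff_left] at htb
    linarith
  have hZB : Z - B ≠ 0 := by
    intro h0
    rw [sub_eq_zero.1 h0] at htb
    simp only [focalDiff, sub_self, norm_zero, mul_zero, sub_zero] at htb
    rw [norm_sub_rev] at htb
    nlinarith
  have hr : 0 < ‖Z - A‖ := norm_pos_iff.2 hZA
  have hs : 0 < ‖Z - B‖ := norm_pos_iff.2 hZB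
  have hrs : k * ‖Z - A‖ ≤ ‖Z - B‖ := by
    have h1 : ‖A - B‖ ≤ ‖Z - A‖ + ‖Z - B‖ := by
      have := norm_sub_le_norm_sub_add_norm_sub A Z B
      rwa [norm_sub_rev A Z] at this
    unfold focalDiff at htb
    nlinarith [mul_le_mul_of_nonneg_left h1 (sub_pos.2 hk1).le]
  set N := ‖Z - A‖⁻¹ • (Z - A) - (k * ‖Z - B‖⁻¹) • (Z - B) with hN
  have support : ∀ V, focalDiff k A B V ≤ b → inner ℝ N (V - Z) ≤ 0 := by
    intro V hV
    by_contra hcon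
    push Not at hcon
    have := norm_sub_lt_of_inner_pos hk hk1 hZA hZB hrs hcon
    rw [add_comm (Z - A), add_comm (Z - B), sub_add_sub_cancel, sub_add_sub_cancel] at this
    unfold focalDiff at htb hV
    linarith
  have hNW : inner ℝ N (W - Z) ≤ 0 := by
    have e : W - Z = a • (X - Z) + c • (Y - Z) := by
      rw [hWdef, smul_sub, smul_sub]
      have : Z = a • Z + c • Z := by rw [← add_smul, hac, one_smul]
      nth_rw 1 [this]
      abel
    rw [e, inner_add_right, real_inner_smul_right, real_inner_smul_right]
    nlinarith [mul_nonneg ha (neg_nonneg.2 (support X hX)),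
      mul_nonneg hc (neg_nonneg.2 (support Y hY))]
  have hNZ : 0 < inner ℝ N (Z - A) := by
    rw [hN, inner_sub_left, real_inner_smul_left, real_inner_smul_left,
      real_inner_self_eq_norm_sq]
    have h1 := real_inner_le_norm (Z - B) (Z - A)
    have h2 : ‖Z - B‖⁻¹ * inner ℝ (Z - B) (Z - A) ≤ ‖Z - A‖ := by
      rw [inv_mul_le_iff₀ hs]
      exact h1
    have h3 : ‖Z - A‖⁻¹ * ‖Z - A‖ ^ 2 = ‖Z - A‖ := by field_simp
    rw [h3]
    nlinarith [mul_le_mul_of_nonneg_left h2 hk.le]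
  have e : t • (W - Z) = (1 - t) • (Z - A) := by
    rw [hZ]
    module
  have e' : t * inner ℝ N (W - Z) = (1 - t) * inner ℝ N (Z - A) := by
    rw [← real_inner_smul_right, e, real_inner_smul_right]
  nlinarith [mul_pos (sub_pos.2 ht1) hNZ]

/-! ### Failure of convexity and concavity at points of the axis -/

theorem norm_smul_add_of_inner_eq_zero {v h : E} (hvh : inner ℝ v h = 0) (t : ℝ) :
    ‖t • v + h‖ = √((t * ‖v‖) ^ 2 + ‖h‖ ^ 2) := by
  rw [eq_comm, Real.sqrt_eq_iff_eq_sq (by positivity) (norm_nonneg _), norm_add_sq_real,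
    real_inner_smul_left, hvh, norm_smul, mul_pow, mul_pow, Real.norm_eq_abs, sq_abs]
  ring

/-- The value of `focalDiff` at a point given by its coordinate along the axis through the foci and
its offset perpendicular to it. -/
theorem focalDiff_axis_add (k : ℝ) (A B : E) {h : E} (hh : inner ℝ (B - A) h = 0) (t : ℝ) :
    focalDiff k A B (A + t • (B - A) + h) =
      √((t * ‖B - A‖) ^ 2 + ‖h‖ ^ 2) - k * √(((1 - t) * ‖B - A‖) ^ 2 + ‖h‖ ^ 2) := by
  have e1 : A + t • (B - A) + h - A = t • (B - A) + h := by abel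
  have e2 : A + t • (B - A) + h - B = (t - 1) • (B - A) + h := by module
  rw [focalDiff, e1, e2, norm_smul_add_of_inner_eq_zero hh, norm_smul_add_of_inner_eq_zero hh]
  ring_nf

theorem focalDiff_axis (k : ℝ) (A B : E) (t : ℝ) :
    focalDiff k A B (A + t • (B - A)) = |t| * ‖B - A‖ - k * (|1 - t| * ‖B - A‖) := by
  have := focalDiff_axis_add k A B (h := 0) (inner_zero_right _) t
  simpa [Real.sqrt_sq_eq_abs, abs_mul] using this

theorem not_convex_focalDiff_le {k b : ℝ} (hk : 0 < k) (hk1 : k < 1) {A B e : E}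
    (he : ‖e‖ = 1) (hAe : inner ℝ (B - A) e = 0)
    (hb : (1 - k) * ‖B - A‖ < b) (hb' : b < ‖B - A‖) :
    ¬ Convex ℝ {X | focalDiff k A B X ≤ b} := by
  intro hconv
  set p := ‖B - A‖ with hp
  have hp0 : 0 < p := by nlinarith
  -- `t` is the coordinate of the point of the level set between the foci
  set t := (b + k * p) / ((1 + k) * p) with ht
  have htp : t * ((1 + k) * p) = b + k * p := by rw [ht]; field_simp
  have ht0 : 0 < t := by rw [ht]; apply div_pos <;> nlinarith
  have ht1 : t < 1 := by rw [ht, div_lt_one (by positivity)]; linarith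
  set r := t * p with hr
  set s := (1 - t) * p with hs
  have hrs : s < k * r := by nlinarith
  have hr0 : 0 < r := by positivity
  have hs0 : 0 < s := mul_pos (by linarith) hp0
  have hbrs : b = r - k * s := by rw [hr, hs]; linarith
  -- This squared offset is positive as `s < k r`, and `s² + q ≤ (k r)²`. Hence `y + s < k (x + r)`
  -- below, and `x² - r² = y² - s²` turns this into `x - r < k (y - s)`.
  set q := 2 * s * (k * r - s) with hq
  have hq0 : 0 < q := by rw [hq]; exact mul_pos (by linarith) (by linarith)
  have hstrict : √(r ^ 2 + q) - k * √(s ^ 2 + q) < b := by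
    have h1 : √(r ^ 2 + q) ^ 2 = r ^ 2 + q := Real.sq_sqrt (by positivity)
    have h2 : √(s ^ 2 + q) ^ 2 = s ^ 2 + q := Real.sq_sqrt (by positivity)
    have h3 : r < √(r ^ 2 + q) := Real.lt_sqrt_of_sq_lt (by linarith)
    have h4 : s < √(s ^ 2 + q) := Real.lt_sqrt_of_sq_lt (by linarith)
    have h5 : √(s ^ 2 + q) ≤ k * r := Real.sqrt_le_iff.2 ⟨by positivity, by nlinarith⟩
    rw [hbrs]
    generalize √(r ^ 2 + q) = x at *
    generalize √(s ^ 2 + q) = y at *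
    have h6 : (x - r) * (x + r) = (y - s) * (y + s) := by nlinarith
    have h7 : y + s < k * (x + r) := by nlinarith
    have h8 : (x - r) * (x + r) < k * (y - s) * (x + r) := by nlinarith
    have := lt_of_mul_lt_mul_right h8 (by linarith)
    linarith
  -- Moving slightly towards `B` keeps both offset points in the sublevel set, but raises their
  -- midpoint on the axis above level `b`.
  have hev : ∀ᶠ τ : ℝ in nhds t,
      √((τ * p) ^ 2 + q) - k * √(((1 - τ) * p) ^ 2 + q) < b := by
    have hc : Continuous fun τ : ℝ => √((τ * p) ^ 2 + q) - k * √(((1 - τ) * p) ^ 2 + q) := by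
      fun_prop
    exact hc.continuousAt.eventually_lt continuousAt_const hstrict
  obtain ⟨τ, hτ, htτ, hτ1⟩ : ∃ τ, (√((τ * p) ^ 2 + q) - k * √(((1 - τ) * p) ^ 2 + q) < b) ∧
      t < τ ∧ τ < 1 :=
    ((hev.filter_mono nhdsWithin_le_nhds).and (Ioo_mem_nhdsGT ht1)).exists
  have hnorm : ‖√q • e‖ ^ 2 = q := by
    rw [norm_smul, he, mul_one, Real.norm_of_nonneg (Real.sqrt_nonneg _), Real.sq_sqrt hq0.le]
  have hmem : ∀ h : E, inner ℝ (B - A) h = 0 → ‖h‖ ^ 2 = q →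
      A + τ • (B - A) + h ∈ {X | focalDiff k A B X ≤ b} := by
    intro h h1 h2
    rw [Set.mem_ofPred_eq, focalDiff_axis_add k A B h1, h2]
    exact hτ.le
  have m1 := hmem (√q • e) (by rw [real_inner_smul_right, hAe, mul_zero]) hnorm
  have m2 := hmem (-(√q • e)) (by rw [inner_neg_right, real_inner_smul_right, hAe]; simp)
    (by rw [norm_neg, hnorm])
  have m3 := hconv m1 m2 (a := 1 / 2) (b := 1 / 2) (by norm_num) (by norm_num) (by norm_num)
  have e3 : (1 / 2 : ℝ) • (A + τ • (B - A) + √q • e) +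
      (1 / 2 : ℝ) • (A + τ • (B - A) + -(√q • e)) = A + τ • (B - A) := by module
  rw [e3, Set.mem_ofPred_eq, focalDiff_axis, abs_of_pos (by linarith), abs_of_pos (by linarith),
    ← hp] at m3
  nlinarith [mul_pos (sub_pos.2 htτ) hp0, mul_pos (mul_pos (sub_pos.2 htτ) hp0) hk]

/-- Around the axis point of the level set beyond the focus `A`, the superlevel set is nowhere
locally convex. -/
theorem exists_not_convex_ball_inter_focalDiff_gt {k b : ℝ} (hk : 0 < k) (hk1 : k < 1)
    {A B e : E} (he : ‖e‖ = 1) (hAe : inner ℝ (B - A) e = 0) (hAB : A ≠ B)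
    (hb : -(k * ‖B - A‖) < b) :
    ∃ Z, focalDiff k A B Z = b ∧
      ∀ r > 0, ¬ Convex ℝ (Metric.ball Z r ∩ {X | focalDiff k A B X ≤ b}ᶜ) := by
  set p := ‖B - A‖ with hp
  have hp0 : 0 < p := norm_pos_iff.2 (sub_ne_zero.2 hAB.symm)
  -- Solution of `t p - k (1 + t) p = b`. Here `r < s`, so a perpendicular offset increases the
  -- distance to `A` more than the distance to `B`: two symmetric points lie outside while their
  -- midpoint is on the surface.
  set t := (b + k * p) / ((1 - k) * p) with ht
  have hk1' : 0 < 1 - k := by linarith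
  have htp : t * ((1 - k) * p) = b + k * p := by rw [ht]; field_simp
  have ht0 : 0 < t := div_pos (by linarith) (by positivity)
  have hZ : focalDiff k A B (A + (-t) • (B - A)) = b := by
    rw [focalDiff_axis, abs_neg, abs_of_pos ht0, abs_of_pos (by linarith), ← hp]
    linarith
  refine ⟨A + (-t) • (B - A), hZ, fun ρ hρ hconv => ?_⟩
  have hmem : ∀ h : E, inner ℝ (B - A) h = 0 → ‖h‖ = ρ / 2 → A + (-t) • (B - A) + h ∈
      Metric.ball (A + (-t) • (B - A)) ρ ∩ {X | focalDiff k A B X ≤ b}ᶜ := by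
    intro h h1 h2
    refine ⟨?_, ?_⟩
    · rw [mem_ball_iff_norm, add_sub_cancel_left, h2]
      linarith
    rw [Set.mem_compl_iff, Set.mem_ofPred_eq, not_le, focalDiff_axis_add k A B h1, h2, ← hp]
    set r := t * p with hr
    set s := (1 + t) * p with hs
    set q := (ρ / 2) ^ 2 with hq
    have hq0 : 0 < q := by positivity
    have hr0 : 0 < r := by positivity
    have hrs : r < s := by rw [hr, hs]; linarith
    have e1 : (-t * p) ^ 2 = r ^ 2 := by rw [hr]; ring
    have e2 : ((1 - -t) * p) ^ 2 = s ^ 2 := by rw [hs]; ring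
    have hbrs : b = r - k * s := by rw [hr, hs]; linarith
    rw [e1, e2, hbrs]
    have h1 : √(r ^ 2 + q) ^ 2 = r ^ 2 + q := Real.sq_sqrt (by positivity)
    have h2 : √(s ^ 2 + q) ^ 2 = s ^ 2 + q := Real.sq_sqrt (by positivity)
    have h3 : r < √(r ^ 2 + q) := Real.lt_sqrt_of_sq_lt (by linarith)
    have h4 : s < √(s ^ 2 + q) := Real.lt_sqrt_of_sq_lt (by linarith)
    have h5 : √(r ^ 2 + q) < √(s ^ 2 + q) := Real.sqrt_lt_sqrt (by positivity) (by nlinarith)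
    generalize √(r ^ 2 + q) = x at *
    generalize √(s ^ 2 + q) = y at *
    have h6 : (x - r) * (x + r) = (y - s) * (y + s) := by nlinarith
    have h7 : (y - s) * (x + r) < (x - r) * (x + r) := by nlinarith
    have h8 := lt_of_mul_lt_mul_right h7 (by linarith)
    nlinarith
  have hnorm : ‖(ρ / 2) • e‖ = ρ / 2 := by
    rw [norm_smul, he, mul_one, Real.norm_of_nonneg (by linarith)]
  have m1 := hmem ((ρ / 2) • e) (by rw [real_inner_smul_right, hAe, mul_zero]) hnorm
  have m2 := hmem (-((ρ / 2) • e)) (by rw [inner_neg_right, real_inner_smul_right, hAe]; simp)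
    (by rw [norm_neg, hnorm])
  have m3 := hconv m1 m2 (a := 1 / 2) (b := 1 / 2) (by norm_num) (by norm_num) (by norm_num)
  have e3 : (1 / 2 : ℝ) • (A + (-t) • (B - A) + (ρ / 2) • e) +
      (1 / 2 : ℝ) • (A + (-t) • (B - A) + -((ρ / 2) • e)) = A + (-t) • (B - A) := by module
  rw [e3] at m3
  exact m3.2 hZ.le

end FocalDiff

/-! ### From sublevel sets to enclosed regions -/

theorem enclosedRegion_focalDiff_eq {n : ℕ} {k b : ℝ} (hk : 0 ≤ k) (hk1 : k < 1)
    {A B : EuclideanSpace ℝ (Fin n)} (hb : -(k * ‖A - B‖) ≤ b) :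
    enclosedRegion {X | focalDiff k A B X = b} = {X | focalDiff k A B X ≤ b} := by
  have hcont := continuous_focalDiff k A B
  ext X
  constructor
  · rintro (hX | ⟨hX, hbdd⟩)
    · exact le_of_eq hX
    rw [Set.mem_ofPred_eq]
    by_contra hgt
    push Not at hgt
    have hXA : X ≠ A := by
      rintro rfl
      rw [focalDiff_left] at hgt
      linarith
    have hpos : 0 < ‖X - A‖ := norm_pos_iff.2 (sub_ne_zero.2 hXA)
    -- The outward ray from `X` never returns to level `b`, so the component of `X` is unbounded.
    have hsub : (fun t : ℝ => A + t • (X - A)) '' Set.Ici 1 ⊆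
        connectedComponentIn {X | focalDiff k A B X = b}ᶜ X := by
      refine IsPreconnected.subset_connectedComponentIn ?_ ⟨1, Set.mem_Ici.2 le_rfl, by simp⟩ ?_
      · exact isPreconnected_Ici.image _ (by fun_prop)
      · rintro _ ⟨t, ht, rfl⟩
        rw [Set.mem_compl_iff, Set.mem_ofPred_eq]
        rcases eq_or_lt_of_le (Set.mem_Ici.1 ht) with rfl | ht
        · simpa using hgt.ne'
        · exact (hgt.trans (focalDiff_lt_of_one_lt hk hk1 hXA ht)).ne'
    obtain ⟨R, hR⟩ := (hbdd.subset hsub).subset_closedBall A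
    have h1 : (1 : ℝ) ≤ 1 + |R| / ‖X - A‖ := by
      have : 0 ≤ |R| / ‖X - A‖ := by positivity
      linarith
    have h2 := hR ⟨1 + |R| / ‖X - A‖, h1, rfl⟩
    rw [mem_closedBall_iff_norm, add_sub_cancel_left, norm_smul,
      Real.norm_of_nonneg (by linarith), add_mul, div_mul_cancel₀ _ hpos.ne'] at h2
    linarith [le_abs_self R]
  · intro hX
    rcases eq_or_lt_of_le (show focalDiff k A B X ≤ b from hX) with hX | hX
    · exact Or.inl hX
    refine Or.inr ⟨hX.ne, ?_⟩
    refine (Metric.isBounded_closedBall (x := A) (r := (b + k * ‖A - B‖) / (1 - k))).subset ?_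
    intro Y hY
    -- A component of the complement cannot cross level `b`, so it stays in the bounded sublevel
    -- set.
    have hYb : focalDiff k A B Y < b := by
      by_contra hcon
      push Not at hcon
      obtain ⟨V, hV, hVb⟩ := isPreconnected_connectedComponentIn.intermediate_value
        (mem_connectedComponentIn (F := {X | focalDiff k A B X = b}ᶜ) hX.ne) hY
        hcont.continuousOn ⟨hX.le, hcon⟩
      exact connectedComponentIn_subset _ _ hV hVb
    rw [mem_closedBall_iff_norm, le_div_iff₀ (by linarith)]
    have := focalDiff_lower_bound hk A B Y
    linarith

theorem isConvexSurface_focalDiff {n : ℕ} {k b : ℝ} (hk : 0 < k) (hk1 : k < 1)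
    {A B : EuclideanSpace ℝ (Fin n)} (hb : -(k * ‖A - B‖) ≤ b) (hb' : b ≤ (1 - k) * ‖A - B‖) :
    IsConvexSurface {X | focalDiff k A B X = b} := by
  rw [IsConvexSurface, enclosedRegion_focalDiff_eq hk.le hk1 hb]
  exact convex_focalDiff_le hk hk1 hb'

theorem exists_norm_eq_one_inner_eq_zero {n : ℕ} (hn : 2 ≤ n) (v : EuclideanSpace ℝ (Fin n)) :
    ∃ e : EuclideanSpace ℝ (Fin n), ‖e‖ = 1 ∧ inner ℝ v e = 0 := by
  obtain ⟨w, hw0, hw⟩ : ∃ w : EuclideanSpace ℝ (Fin n), w ≠ 0 ∧ inner ℝ v w = 0 := by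
    by_contra hcon
    push Not at hcon
    have hbot : (ℝ ∙ v)ᗮ = ⊥ := by
      rw [Submodule.eq_bot_iff]
      intro x hx
      by_contra hx0
      exact hcon x hx0 (Submodule.mem_orthogonal_singleton_iff_inner_right.1 hx)
    have htop := (Submodule.orthogonal_eq_bot_iff).1 hbot
    have h1 := finrank_span_le_card (R := ℝ) ({v} : Set (EuclideanSpace ℝ (Fin n)))
    rw [htop, finrank_top, finrank_euclideanSpace_fin, Set.toFinset_singleton,
      Finset.card_singleton] at h1
    omega
  refine ⟨‖w‖⁻¹ • w, norm_smul_inv_norm hw0, ?_⟩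
  rw [real_inner_smul_right, hw, mul_zero]

theorem not_isConvexSurface_and_not_isConcaveSurface_focalDiff {n : ℕ} (hn : 2 ≤ n) {k b : ℝ}
    (hk : 0 < k) (hk1 : k < 1) {A B : EuclideanSpace ℝ (Fin n)}
    (hb : (1 - k) * ‖A - B‖ < b) (hb' : b < ‖A - B‖) :
    ¬ IsConvexSurface {X | focalDiff k A B X = b} ∧
      ¬ IsConcaveSurface {X | focalDiff k A B X = b} := by
  have hp : 0 < ‖A - B‖ := by nlinarith [norm_nonneg (A - B)]
  have hlow : -(k * ‖A - B‖) < b := by nlinarith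
  obtain ⟨e, he, hAe⟩ := exists_norm_eq_one_inner_eq_zero hn (B - A)
  have hreg := enclosedRegion_focalDiff_eq hk.le hk1 hlow.le
  constructor
  · rw [IsConvexSurface, hreg]
    rw [norm_sub_rev] at hb hb'
    exact not_convex_focalDiff_le hk hk1 he hAe hb hb'
  · intro hconc
    have hAB : A ≠ B := sub_ne_zero.1 (norm_pos_iff.1 hp)
    rw [norm_sub_rev] at hlow
    obtain ⟨Z, hZ, hZconv⟩ := exists_not_convex_ball_inter_focalDiff_gt hk hk1 he hAe hAB hlow
    obtain ⟨r, hr, hrconv⟩ := hconc Z hZ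
    rw [hreg] at hrconv
    exact hZconv r hr hrconv

/-! ### Reduction of the two ranges of `κ` to `0 < k < 1` -/

theorem oval_eq_focalDiff {n : ℕ} (κ : ℝ) (P : EuclideanSpace ℝ (Fin n)) (b : ℝ) :
    oval κ P b = {X | focalDiff (-κ) 0 P X = b} := by
  ext X
  simp [oval, focalDiff]

theorem oval_eq_focalDiff_swap {n : ℕ} {κ : ℝ} (hκ : κ ≠ 0) (P : EuclideanSpace ℝ (Fin n))
    (b : ℝ) : oval κ P b = {X | focalDiff (-κ⁻¹) P 0 X = b / κ} := by
  ext X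
  simp only [oval, focalDiff, Set.mem_ofPred_eq, sub_zero]
  rw [eq_div_iff hκ]
  have : (‖X - P‖ - -κ⁻¹ * ‖X‖) * κ = ‖X‖ + κ * ‖X - P‖ := by
    field_simp
    ring
  rw [this]

theorem theorem3p3 {n : ℕ} (hn : 2 ≤ n) (κ : ℝ) (P : EuclideanSpace ℝ (Fin n)) :
    (-1 < κ → κ < 0 →
      (∀ b ∈ Set.Icc (κ * ‖P‖) ((1 + κ) * ‖P‖), IsConvexSurface (oval κ P b)) ∧
      (∀ b ∈ Set.Ioo ((1 + κ) * ‖P‖) ‖P‖,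
        ¬ IsConvexSurface (oval κ P b) ∧ ¬ IsConcaveSurface (oval κ P b))) ∧
    (κ < -1 →
      (∀ b ∈ Set.Ico ((1 + κ) * ‖P‖) ‖P‖, IsConvexSurface (oval κ P b)) ∧
      (∀ b ∈ Set.Ioo (κ * ‖P‖) ((1 + κ) * ‖P‖),
        ¬ IsConvexSurface (oval κ P b) ∧ ¬ IsConcaveSurface (oval κ P b))) := by
  refine ⟨fun h1 h0 => ⟨fun b hb => ?_, fun b hb => ?_⟩, fun h1 => ?_⟩
  · rw [oval_eq_focalDiff]
    apply isConvexSurface_focalDiff (by linarith) (by linarith) <;>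
      rw [zero_sub, norm_neg] <;> linarith [hb.1, hb.2]
  · rw [oval_eq_focalDiff]
    apply not_isConvexSurface_and_not_isConcaveSurface_focalDiff hn (by linarith) (by linarith) <;>
      rw [zero_sub, norm_neg] <;> linarith [hb.1, hb.2]
  have hκ : κ < 0 := by linarith
  have hinv : -κ⁻¹ < 1 := by
    have := inv_lt_one_of_one_lt₀ (a := -κ) (by linarith)
    rwa [inv_neg] at this
  have hinv0 : 0 < -κ⁻¹ := neg_pos.2 (inv_lt_zero.2 hκ)
  have hκκ : κ⁻¹ * κ = 1 := inv_mul_cancel₀ hκ.ne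
  refine ⟨fun b hb => ?_, fun b hb => ?_⟩ <;> rw [oval_eq_focalDiff_swap hκ.ne]
  · apply isConvexSurface_focalDiff hinv0 hinv <;> rw [sub_zero]
    · rw [le_div_iff_of_neg hκ]
      linear_combination hb.2.le - ‖P‖ * hκκ
    · rw [div_le_iff_of_neg hκ]
      linear_combination hb.1 + ‖P‖ * hκκ
  · apply not_isConvexSurface_and_not_isConcaveSurface_focalDiff hn hinv0 hinv <;> rw [sub_zero]
    · rw [lt_div_iff_of_neg hκ]
      linear_combination hb.2 - ‖P‖ * hκκ
    · rw [div_lt_iff_of_neg hκ]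
      linear_combination hb.1
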